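/- All spaces are Tychonoff (completely regular and $T_0$) and all maps between spaces are continuous. For a space $X$, let $\mathcal T_X$ denote its topology. Definitions. - $X$ is I-favorable if player I has a winning strategy in the open-open game: there is a function $\sigma$ assigning to every finite (possibly empty) sequence of open subsets of $X$ a non-empty open subset of $X$, such that $\bigcup_{n\ge 0}U_n$ is dense in $X$ for every sequence $U_0,U_1,\dots$ of non-empty open sets with $U_0\subset\sigma(\varnothing)$ and $U_{n+1}\subset\sigma(U_0,\dots,U_n)$ for all $n\ge 0$. - An embedding $X\subset Y$ is $\pi$-regular if there is a function $\mathrm e\colon\mathcal T_X\to\mathcal T_Y$ such that for all $U,V\in\mathcal T_X$: $\mathrm e(U)\cap \mathrm e(V)=\varnothing$ whenever $U\cap V=\varnothing$, and $\mathrm e(U)\cap X$ is a dense subset of $U$. - A map $f\colon X\to Y$ is skeletal if $\mathrm{Int}\,\overline{f(U)}\neq\varnothing$ for every non-empty open $U\subset X$. - An inverse system $S=\{X_\alpha,p^\beta_\alpha,A\}$, where $A$ is a non-empty directed partially ordered set, is almost $\sigma$-continuous if every non-empty countable chain in $A$ has a supremum in $A$ and, for every increasing sequence $\alpha_1\le\alpha_2\le\cdots$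 in $A$ with supremum $\beta$, the canonical map $X_\beta\to\varprojlim\{X_{\alpha_n},p^{\alpha_{n+1}}_{\alpha_n}\}$ is an embedding with dense image. - $X$ is the almost limit of $S$ if $X$ can be embedded in $\varprojlim S$ so that $p_\alpha(X)=X_\alpha$ for every $\alpha\in A$, where $p_\alpha\colon\varprojlim S\to X_\alpha$ is the limit projection. - $X$ is skeletally generated if it is the almost limit of an almost $\sigma$-continuous inverse system of second countable spaces with skeletal bonding maps. Theorem 1.1. For every non-empty space $X$ the following conditions are equivalent: (1) $X$ is I-favorable; (2) every embedding of $X$ in another space $Y$ is $\pi$-regular; (3) $X$ is skeletally generated. -/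

import Mathlib

open TopologicalSpace Set

universe u v w

/-- Player I has a winning strategy in the open-open game on `X`. A strategy `σ` assigns to every
finite sequence of open sets (the previous moves of player II) a non-empty open set (the next move
of player I). It is winning if, whenever player II answers by non-empty open sets
`U n ⊆ σ (U 0, …, U (n - 1))`, the union of all the `U n` is dense. -/
def IFavorable (X : Type u) [TopologicalSpace X] : Prop :=
  ∃ σ : List (Opens X) → Opens X,
    (∀ l, (σ l : Set X).Nonempty) ∧
    ∀ U : ℕ → Opens X,
      (∀ n, (U n : Set X).Nonempty) →
      (∀ n, U n ≤ σ ((List.range n).map U)) →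
      Dense (⋃ n, (U n : Set X))

/-- A map `f` (in practice an embedding, identifying `X` with a subspace of `Y`) is `π`-regular if
there is `e : T_X → T_Y` preserving disjointness and such that, for every open `U` in `X`, the
trace of `e U` on `X` is a dense subset of `U`. -/
def IsPiRegular {X : Type u} {Y : Type v} [TopologicalSpace X] [TopologicalSpace Y]
    (f : X → Y) : Prop :=
  ∃ e : Opens X → Opens Y,
    (∀ U V : Opens X, Disjoint U V → Disjoint (e U) (e V)) ∧
    ∀ U : Opens X, f ⁻¹' (e U : Set Y) ⊆ (U : Set X) ∧
      (U : Set X) ⊆ closure (f ⁻¹' (e U : Set Y))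

/-- Every embedding of `X` in a Tychonoff space is `π`-regular. -/
def EveryEmbeddingPiRegular (X : Type u) [TopologicalSpace X] : Prop :=
  ∀ (Y : Type (max u v)) [TopologicalSpace Y] [T35Space Y] (f : X → Y),
    Topology.IsEmbedding f → IsPiRegular f

/-- A skeletal map: the closure of the image of every non-empty open set has non-empty interior. -/
def IsSkeletal {X : Type u} {Y : Type v} [TopologicalSpace X] [TopologicalSpace Y]
    (f : X → Y) : Prop :=
  ∀ U : Set X, IsOpen U → U.Nonempty → (interior (closure (f '' U))).Nonempty

/-- An inverse system of Tychonoff spaces and continuous bonding maps over a partially ordered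
index set. (Directedness of the index set is required where systems are used.) -/
structure SpaceSystem (A : Type u) [PartialOrder A] where
  space : A → Type v
  [top : ∀ a, TopologicalSpace (space a)]
  [tychonoff : ∀ a, T35Space (space a)]
  bond : ∀ {a b : A}, a ≤ b → space b → space a
  continuous_bond : ∀ {a b : A} (h : a ≤ b), Continuous (bond h)
  bond_refl : ∀ (a : A) (x : space a), bond (le_refl a) x = x
  bond_bond : ∀ {a b c : A} (hab : a ≤ b) (hbc : b ≤ c) (x : space c),
    bond hab (bond hbc x) = bond (hab.trans hbc) x

namespace SpaceSystem

attribute [instance] SpaceSystem.top SpaceSystem.tychonoff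

variable {A : Type u} [PartialOrder A]

/-- The limit of an inverse system: the set of all threads in the product, with the subspace
topology of the product topology. -/
def limit (S : SpaceSystem.{u, v} A) : Set (∀ a, S.space a) :=
  {x | ∀ (a b : A) (h : a ≤ b), S.bond h (x b) = x a}

/-- The inverse sequence obtained from `S` along an increasing sequence of indices. -/
def alongSeq (S : SpaceSystem.{u, v} A) (a : ℕ → A) (ha : Monotone a) :
    SpaceSystem.{0, v} ℕ where
  space n := S.space (a n)
  bond h := S.bond (ha h)
  continuous_bond h := S.continuous_bond (ha h)
  bond_refl n x := S.bond_refl (a n) x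
  bond_bond hab hbc x := S.bond_bond (ha hab) (ha hbc) x

/-- The canonical map from `X_b` to the limit of the inverse sequence along `a`, for an upper bound
`b` of `a`; its coordinates are the bonding maps. -/
def toSeqLimit (S : SpaceSystem.{u, v} A) (a : ℕ → A) (ha : Monotone a) (b : A)
    (hb : ∀ n, a n ≤ b) (x : S.space b) : (S.alongSeq a ha).limit :=
  ⟨fun n => S.bond (hb n) x, fun _ _ h => S.bond_bond (ha h) (hb _) x⟩

/-- An inverse system is almost `σ`-continuous if every (non-empty) countable chain of indices has
a supremum, and if for every increasing sequence of indices with supremum `b` the canonical map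
identifies `X_b` with a dense subspace of the limit of the corresponding inverse sequence. -/
structure IsAlmostSigmaContinuous (S : SpaceSystem.{u, v} A) : Prop where
  exists_sup : ∀ C : Set A, C.Nonempty → C.Countable → IsChain (· ≤ ·) C → ∃ b, IsLUB C b
  dense_embedding : ∀ (a : ℕ → A) (ha : Monotone a) (b : A) (hb : IsLUB (range a) b),
    Topology.IsEmbedding (S.toSeqLimit a ha b fun n => hb.1 (mem_range_self n)) ∧
    DenseRange (S.toSeqLimit a ha b fun n => hb.1 (mem_range_self n))

/-- `X` is the almost limit of `S`: it is embedded in the limit of `S` so that all limit projections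
map `X` onto the spaces of the system. -/
def IsAlmostLimit (S : SpaceSystem.{u, v} A) (X : Type w) [TopologicalSpace X] : Prop :=
  ∃ φ : X → S.limit, Topology.IsEmbedding φ ∧
    ∀ a, Function.Surjective fun x => (φ x : ∀ a, S.space a) a

end SpaceSystem

/-- `X` is skeletally generated: it is the almost limit of an almost `σ`-continuous inverse system,
over a directed index set, of second countable (Tychonoff) spaces and skeletal bonding maps. -/
def SkeletallyGenerated (X : Type u) [TopologicalSpace X] : Prop :=
  ∃ (A : Type u) (_ : PartialOrder A) (_ : Nonempty A) (_ : IsDirectedOrder A)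
    (S : SpaceSystem.{u, u} A),
    S.IsAlmostSigmaContinuous ∧
    (∀ a, SecondCountableTopology (S.space a)) ∧
    (∀ (a b : A) (h : a ≤ b), IsSkeletal (S.bond h)) ∧
    S.IsAlmostLimit X

/-! Both hard implications rest on regular families: families `N` of open sets in which every
non-empty open `U` has a reduction, a non-empty `r ∈ N` such that no non-empty member of `N` below
`r` misses `U`.

(1) to (2): a family closed under a winning strategy is regular (`IsWinning.isRegularFamily`). The
extension operator is built by induction on the cardinality of closed families. Countable families
are handled by separating each open set from its exterior in `Y`. An uncountable family is a
well-ordered union of smaller closed families, and reductions make it possible to glue their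
operators (`exists_isExtender_of_rank`).

(2) to (3): embed `X` in a power of the real line. By the countable chain condition, each `e (cozero
g)` has a dense subset depending on countably many coordinates. A countable family of functions
closed under adding these coordinates has regular cozero sets (`OpClosed.isRegularFunctionFamily`),
and this makes the restriction of coordinates skeletal.

(3) to (1): player I follows an increasing sequence of indices that captures a basic part of every
move of player II, and plays all members of countable π-bases of the spaces met. At the supremum of
the indices, skeletality transfers density to `X`. -/

/-! ### Closure of a set under finitary operations -/

section OpClosure

variable {κ : Type} {α : Type u}

/-- `M` is closed under the operations `F k`, each of which takes finite lists of arguments. -/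
def OpClosed (F : κ → List α → α) (M : Set α) : Prop :=
  ∀ k l, (∀ a ∈ l, a ∈ M) → F k l ∈ M

/-- The stages of the generation of the closure of a set under finitary operations. -/
def opStage (F : κ → List α → α) (S : Set α) : ℕ → Set α
  | 0 => S
  | n + 1 => opStage F S n ∪
      range fun p : κ × List (opStage F S n) => F p.1 (p.2.map Subtype.val)

/-- The closure of a set under finitary operations. -/
def opClosure (F : κ → List α → α) (S : Set α) : Set α := ⋃ n, opStage F S n

variable {F : κ → List α → α} {S M : Set α}

lemma subset_opClosure : S ⊆ opClosure F S := fun _ h => mem_iUnion.2 ⟨0, h⟩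

lemma opStage_mono : Monotone (opStage F S) :=
  monotone_nat_of_le_succ fun _ => subset_union_left

lemma OpClosed.iUnion {ι : Type w} [Nonempty ι] {N : ι → Set α} (hd : Directed (· ⊆ ·) N)
    (hN : ∀ i k l, (∀ a ∈ l, a ∈ N i) → F k l ∈ ⋃ j, N j) : OpClosed F (⋃ i, N i) := by
  classical
  intro k l hl
  obtain ⟨i, hi⟩ := hd.exists_mem_subset_of_finset_subset_biUnion (s := l.toFinset)
    (fun a ha => hl a (by simpa using ha))
  exact hN i k l fun a ha => hi (by simpa using ha)

lemma opClosed_opClosure : OpClosed F (opClosure F S) := by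
  refine OpClosed.iUnion (opStage_mono.directed_le) fun n k l hl => mem_iUnion.2 ⟨n + 1, Or.inr ?_⟩
  lift l to List (opStage F S n) using hl
  exact ⟨(k, l), rfl⟩

lemma opClosure_min (hM : OpClosed F M) (h : S ⊆ M) : opClosure F S ⊆ M := by
  refine iUnion_subset fun n => ?_
  induction n with
  | zero => exact h
  | succ n ih =>
    refine union_subset ih ?_
    rintro _ ⟨⟨k, l⟩, rfl⟩
    refine hM _ _ fun a ha => ?_
    obtain ⟨b, -, rfl⟩ := List.mem_map.1 ha
    exact ih b.2

lemma opClosure_mono {T : Set α} (h : S ⊆ T) : opClosure F S ⊆ opClosure F T :=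
  opClosure_min opClosed_opClosure (h.trans subset_opClosure)

open Cardinal in
lemma mk_opClosure_le [Countable κ] {c : Cardinal.{u}} (hc : ℵ₀ ≤ c) (hS : #S ≤ c) :
    #(opClosure F S) ≤ c := by
  have hst : ∀ n, #(opStage F S n) ≤ c := by
    intro n
    induction n with
    | zero => exact hS
    | succ n ih =>
      refine (mk_union_le _ _).trans (add_le_of_le hc ih ?_)
      have h1 := mk_range_le_lift (f := fun p : κ × List (opStage F S n) =>
        F p.1 (p.2.map Subtype.val))
      rw [lift_id, lift_id] at h1
      refine h1.trans ?_
      rw [mk_prod]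
      refine mul_le_of_le hc ?_ ?_
      · simpa using (lift_le.{u}.2 (mk_le_aleph0 (α := κ))).trans (by simpa using hc)
      · simpa using (mk_list_le_max _).trans (max_le hc ih)
  rw [← lift_le.{0}]
  refine (mk_iUnion_le_lift _).trans ?_
  refine mul_le_of_le (by simpa using hc) (by simpa using hc) ?_
  exact ciSup_le' fun n => by simpa using hst n

lemma countable_opClosure [Countable κ] (hS : S.Countable) : (opClosure F S).Countable := by
  rw [← Cardinal.le_aleph0_iff_set_countable] at *
  exact mk_opClosure_le le_rfl hS

end OpClosure

/-! ### Regular families, and extension operators on countable families -/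

section Favorable

variable {X : Type u} [TopologicalSpace X]

/-- A family `N` of open sets is regular if every non-empty open `U` has a reduction `r ∈ N`: all
non-empty members of `N` below `r` meet `U`. -/
def IsRegularFamily (N : Set (Opens X)) : Prop :=
  ∀ U : Opens X, U ≠ ⊥ → ∃ r ∈ N, r ≠ ⊥ ∧ ∀ s ∈ N, s ≠ ⊥ → s ≤ r → ¬ Disjoint s U

/-- The open set `A` is a dense subset of the open set `U`. -/
def DenseIn (A U : Opens X) : Prop :=
  A ≤ U ∧ ∀ W : Opens X, W ≠ ⊥ → W ≤ U → ¬ Disjoint W A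

lemma DenseIn.subset_closure {A U : Opens X} (h : DenseIn A U) :
    (U : Set X) ⊆ closure (A : Set X) := by
  intro x hx
  rw [mem_closure_iff]
  intro o ho hxo
  have := h.2 (⟨o, ho⟩ ⊓ U) ((Opens.ne_bot_iff_nonempty _).2 ⟨x, hxo, hx⟩) inf_le_right
  rw [← Opens.coe_disjoint, Set.not_disjoint_iff] at this
  obtain ⟨y, hy, hyA⟩ := this
  exact ⟨y, hy.1, hyA⟩

lemma ne_bot_of_not_disjoint {U V : Opens X} (h : ¬ Disjoint U V) : U ⊓ V ≠ ⊥ :=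
  fun h' => h (disjoint_iff.2 h')

lemma DenseIn.inf {A B U : Opens X} (hA : DenseIn A U)
    (hB : ∀ W : Opens X, W ≠ ⊥ → W ≤ U → ¬ Disjoint W B) : DenseIn (A ⊓ B) U := by
  refine ⟨inf_le_left.trans hA.1, fun W hW hWU hd => ?_⟩
  refine hB (W ⊓ A) (ne_bot_of_not_disjoint (hA.2 W hW hWU)) (inf_le_left.trans hWU) ?_
  rwa [disjoint_assoc]

/-- The strategy `σ` of player I wins the open-open game on `X`. -/
def IsWinning (σ : List (Opens X) → Opens X) : Prop :=
  (∀ l, (σ l : Set X).Nonempty) ∧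
    ∀ U : ℕ → Opens X, (∀ n, (U n : Set X).Nonempty) →
      (∀ n, U n ≤ σ ((List.range n).map U)) → Dense (⋃ n, (U n : Set X))

/-- If `U` had no reduction, player II could answer every move `r ∈ N` by a non-empty `s ∈ N` below
`r` that misses `U`. The play would stay in `N` and its union would miss `U`. -/
lemma IsWinning.isRegularFamily {σ : List (Opens X) → Opens X} (hσ : IsWinning σ)
    {N : Set (Opens X)} (hN : ∀ l, (∀ a ∈ l, a ∈ N) → σ l ∈ N) : IsRegularFamily N := by
  by_contra hreg
  simp only [IsRegularFamily] at hreg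
  push Not at hreg
  obtain ⟨U, hU, h⟩ := hreg
  choose! s hsN hs0 hsr hsU using h
  let L : ℕ → List (Opens X) := fun n => Nat.rec [] (fun _ l => l ++ [s (σ l)]) n
  have hL0 : L 0 = [] := rfl
  have hLs : ∀ n, L (n + 1) = L n ++ [s (σ (L n))] := fun n => rfl
  have hLN : ∀ n, ∀ a ∈ L n, a ∈ N := by
    intro n
    induction n with
    | zero => simp [hL0]
    | succ n ih =>
      intro a ha
      rw [hLs, List.mem_append, List.mem_singleton] at ha
      rcases ha with ha | rfl
      · exact ih a ha
      · exact hsN _ (hN _ ih) ((Opens.ne_bot_iff_nonempty _).2 (hσ.1 _))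
  have hLr : ∀ n, (List.range n).map (fun n => s (σ (L n))) = L n := by
    intro n
    induction n with
    | zero => simp [hL0]
    | succ n ih => rw [List.range_succ, List.map_append, ih, hLs]; rfl
  have hσN : ∀ n, σ (L n) ∈ N := fun n => hN _ (hLN n)
  have hσ0 : ∀ n, σ (L n) ≠ ⊥ := fun n => (Opens.ne_bot_iff_nonempty _).2 (hσ.1 _)
  have hd := hσ.2 (fun n => s (σ (L n)))
    (fun n => (Opens.ne_bot_iff_nonempty _).1 (hs0 _ (hσN n) (hσ0 n)))
    (fun n => by rw [hLr]; exact hsr _ (hσN n) (hσ0 n))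
  obtain ⟨x, hxU, hx⟩ := hd.inter_open_nonempty _ U.isOpen ((Opens.ne_bot_iff_nonempty _).1 hU)
  obtain ⟨n, hn⟩ := mem_iUnion.1 hx
  exact Set.disjoint_left.1 (Opens.coe_disjoint.2 (hsU _ (hσN n) (hσ0 n))) hn hxU

/-- In an I-favorable space every `π`-base has a countable subfamily with dense union. -/
lemma IsWinning.exists_countable_dense {σ : List (Opens X) → Opens X} (hσ : IsWinning σ)
    {B : Set (Opens X)} (hB : ∀ U : Opens X, U ≠ ⊥ → ∃ V ∈ B, V ≠ ⊥ ∧ V ≤ U) :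
    ∃ C ⊆ B, C.Countable ∧ ∀ U : Opens X, U ≠ ⊥ → ∃ V ∈ C, ¬ Disjoint V U := by
  choose! g hgB hg0 hgU using hB
  -- Closing under `g` as well puts a member of `B` below each reduction `r`; it lies in `N`, so it
  -- meets `U`.
  let F : Bool → List (Opens X) → Opens X := fun b l => bif b then σ l else g (l.headD ⊤)
  let N := opClosure F ∅
  have hN : OpClosed F N := opClosed_opClosure
  refine ⟨N ∩ B, inter_subset_right, (countable_opClosure countable_empty).mono inter_subset_left,
    fun U hU => ?_⟩
  obtain ⟨r, hrN, hr0, hr⟩ := hσ.isRegularFamily (N := N) (fun l hl => hN true l hl) U hU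
  have hgN : g r ∈ N := hN false [r] (by simpa using hrN)
  exact ⟨g r, ⟨hgN, hgB r hr0⟩, hr _ hgN (hg0 r hr0) (hgU r hr0)⟩

variable {Y : Type v} [TopologicalSpace Y] {σ : List (Opens X) → Opens X}

lemma exists_cozero_eq_iUnion (φ : ℕ → Y → ℝ) (hφ : ∀ n, Continuous (φ n))
    (h0 : ∀ n y, 0 ≤ φ n y) (h1 : ∀ n y, φ n y ≤ 1) :
    ∃ g : Y → ℝ, Continuous g ∧ (∀ y, 0 ≤ g y) ∧ ∀ y, 0 < g y ↔ ∃ n, 0 < φ n y := by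
  have hb : ∀ n y, ‖(1 / 2 : ℝ) ^ n * φ n y‖ ≤ (1 / 2) ^ n := fun n y => by
    rw [Real.norm_of_nonneg (mul_nonneg (by positivity) (h0 n y))]
    exact mul_le_of_le_one_right (by positivity) (h1 n y)
  have hnn : ∀ n y, 0 ≤ (1 / 2 : ℝ) ^ n * φ n y := fun n y => mul_nonneg (by positivity) (h0 n y)
  have hsum : ∀ y, Summable fun n => (1 / 2 : ℝ) ^ n * φ n y := fun y =>
    Summable.of_norm_bounded summable_geometric_two fun n => hb n y
  refine ⟨fun y => ∑' n, (1 / 2) ^ n * φ n y, continuous_tsum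
    (fun n => (hφ n).const_mul _) summable_geometric_two hb, fun y => tsum_nonneg fun n => hnn n y,
    fun y => ⟨fun h => ?_, fun ⟨n, hn⟩ => ?_⟩⟩
  · by_contra! hc
    have : ∀ n, φ n y = 0 := fun n => le_antisymm (hc n) (h0 n y)
    simp [this] at h
  · exact (hsum y).tsum_pos (fun m => hnn m y) n (by positivity)

/-- Traces of cozero sets of `Y` that lie inside `U` or miss `U` form a π-base. Countably many have
dense union, and those inside `U` unite to the trace of a single cozero set. -/
lemma IsWinning.exists_cozero_denseIn [CompletelyRegularSpace Y] (hσ : IsWinning σ) {f : X → Y}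
    (hf : Topology.IsEmbedding f) (U : Opens X) :
    ∃ g : Y → ℝ, Continuous g ∧ (∀ y, 0 ≤ g y) ∧ (∀ x, 0 < g (f x) → x ∈ U) ∧
      ∀ W : Opens X, W ≠ ⊥ → W ≤ U → ∃ x ∈ W, 0 < g (f x) := by
  let B : Set (Opens X) := {V | (∃ φ : Y → ℝ, Continuous φ ∧ (∀ y, 0 ≤ φ y) ∧ (∀ y, φ y ≤ 1) ∧
    ∀ x, x ∈ V ↔ 0 < φ (f x)) ∧ (V ≤ U ∨ Disjoint V U)}
  have hB : ∀ V : Opens X, V ≠ ⊥ → ∃ W ∈ B, W ≠ ⊥ ∧ W ≤ V := by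
    have key : ∀ V : Opens X, V ≠ ⊥ → ∃ W : Opens X, (∃ φ : Y → ℝ, Continuous φ ∧ (∀ y, 0 ≤ φ y) ∧
        (∀ y, φ y ≤ 1) ∧ ∀ x, x ∈ W ↔ 0 < φ (f x)) ∧ W ≠ ⊥ ∧ W ≤ V := by
      intro V hV
      obtain ⟨x, hx⟩ := (Opens.ne_bot_iff_nonempty _).1 hV
      obtain ⟨O, hO, hOV⟩ := hf.isInducing.isOpen_iff.1 V.isOpen
      obtain ⟨ψ, hψ, hψx, hψO⟩ := CompletelyRegularSpace.completely_regular (f x) Oᶜ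
        hO.isClosed_compl (by
          have : x ∈ f ⁻¹' O := by rw [hOV]; exact hx
          simpa using this)
      have hφ : Continuous fun y => 1 - (ψ y : ℝ) := by fun_prop
      refine ⟨⟨{x | 0 < 1 - (ψ (f x) : ℝ)}, isOpen_lt continuous_const (hφ.comp hf.continuous)⟩,
        ⟨fun y => 1 - (ψ y : ℝ), hφ, fun y => sub_nonneg.2 (ψ y).2.2,
          fun y => sub_le_self _ (ψ y).2.1, fun x => Iff.rfl⟩,
        (Opens.ne_bot_iff_nonempty _).2 ⟨x, by simp [hψx]⟩, ?_⟩
      intro z hz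
      rw [← SetLike.mem_coe, ← hOV]
      by_contra hzO
      have h1 : ψ (f z) = 1 := hψO hzO
      have hz' : 0 < 1 - (ψ (f z) : ℝ) := hz
      simp [h1] at hz'
    intro V hV
    by_cases hd : Disjoint V U
    · obtain ⟨W, h1, h2, h3⟩ := key V hV
      exact ⟨W, ⟨h1, Or.inr (hd.mono_left h3)⟩, h2, h3⟩
    · obtain ⟨W, h1, h2, h3⟩ := key (V ⊓ U) (ne_bot_of_not_disjoint hd)
      exact ⟨W, ⟨h1, Or.inl (h3.trans inf_le_right)⟩, h2, h3.trans inf_le_left⟩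
  obtain ⟨C, hCB, hC, hCd⟩ := hσ.exists_countable_dense hB
  -- Adding `⊥` allows an enumeration by `ℕ` even when no member of `C` lies in `U`.
  have hne : (C ∩ {V | V ≤ U} ∪ {⊥}).Nonempty := ⟨⊥, Or.inr rfl⟩
  have hcount : (C ∩ {V | V ≤ U} ∪ {⊥}).Countable :=
    (hC.mono inter_subset_left).union (countable_singleton _)
  obtain ⟨V, hV⟩ := hcount.exists_eq_range hne
  have hVφ : ∀ n, ∃ φ : Y → ℝ, Continuous φ ∧ (∀ y, 0 ≤ φ y) ∧ (∀ y, φ y ≤ 1) ∧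
      ∀ x, x ∈ V n ↔ 0 < φ (f x) := by
    intro n
    have hn : V n ∈ C ∩ {V | V ≤ U} ∪ {⊥} := hV ▸ mem_range_self n
    rcases hn with hn | hn
    · exact (hCB hn.1).1
    · rw [mem_singleton_iff.1 hn]
      exact ⟨0, continuous_const, by simp, by simp, fun x => by simp⟩
  choose φ hφc hφ0 hφ1 hφ using hVφ
  obtain ⟨g, hg, hg0, hgφ⟩ := exists_cozero_eq_iUnion φ hφc hφ0 hφ1
  refine ⟨g, hg, hg0, fun x hx => ?_, fun W hW hWU => ?_⟩
  · obtain ⟨n, hn⟩ := (hgφ _).1 hx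
    have hn' : V n ∈ C ∩ {V | V ≤ U} ∪ {⊥} := hV ▸ mem_range_self n
    have hxn := (hφ n x).2 hn
    rcases hn' with h | h
    · exact h.2 hxn
    · rw [mem_singleton_iff.1 h] at hxn
      exact absurd hxn (by simp)
  · obtain ⟨T, hTC, hT⟩ := hCd W hW
    rw [← Opens.coe_disjoint, Set.not_disjoint_iff] at hT
    obtain ⟨x, hxT, hxW⟩ := hT
    have hTU : T ≤ U := (hCB hTC).2.resolve_right fun hd =>
      Set.disjoint_left.1 (Opens.coe_disjoint.2 hd) hxT (hWU hxW)
    obtain ⟨n, rfl⟩ : T ∈ range V := hV ▸ Or.inl ⟨hTC, hTU⟩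
    exact ⟨x, hxW, (hgφ _).2 ⟨n, (hφ n x).1 hxT⟩⟩

/-- Disjoint open sets of `Y` whose traces are dense in `U` and in the exterior of `U`. -/
lemma IsWinning.exists_separation [CompletelyRegularSpace Y] (hσ : IsWinning σ) {f : C(X, Y)}
    (hf : Topology.IsEmbedding f) (U : Opens X) :
    ∃ G H : Opens Y, Disjoint G H ∧ DenseIn (G.comap f) U ∧ DenseIn (H.comap f) Uᶜ := by
  obtain ⟨g, hg, hg0, hgU, hgd⟩ := hσ.exists_cozero_denseIn hf U
  obtain ⟨h, hh, hh0, hhU, hhd⟩ := hσ.exists_cozero_denseIn hf Uᶜ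
  have hUU : ∀ x, x ∈ U → x ∉ Uᶜ := fun x hx hx' =>
    Set.disjoint_left.1 (Opens.coe_disjoint.2 (disjoint_compl_right (a := U))) hx hx'
  have hgz : ∀ x, x ∉ U → g (f x) = 0 := fun x hx =>
    le_antisymm (not_lt.1 fun hlt => hx (hgU x hlt)) (hg0 _)
  have hhz : ∀ x, x ∉ Uᶜ → h (f x) = 0 := fun x hx =>
    le_antisymm (not_lt.1 fun hlt => hx (hhU x hlt)) (hh0 _)
  refine ⟨⟨{y | h y < g y}, isOpen_lt hh hg⟩, ⟨{y | g y < h y}, isOpen_lt hg hh⟩, ?_, ⟨?_, ?_⟩,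
    ⟨?_, ?_⟩⟩
  · rw [← Opens.coe_disjoint, Set.disjoint_left]
    exact fun y h1 h2 => lt_asymm (show h y < g y from h1) h2
  · exact fun x hx => hgU x ((hh0 _).trans_lt hx)
  · intro W hW hWU
    obtain ⟨x, hxW, hx⟩ := hgd W hW hWU
    rw [← Opens.coe_disjoint, Set.not_disjoint_iff]
    exact ⟨x, hxW, show h (f x) < g (f x) by rwa [hhz x (hUU x (hWU hxW))]⟩
  · exact fun x hx => hhU x ((hg0 _).trans_lt hx)
  · intro W hW hWU
    obtain ⟨x, hxW, hx⟩ := hhd W hW hWU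
    rw [← Opens.coe_disjoint, Set.not_disjoint_iff]
    exact ⟨x, hxW, show g (f x) < h (f x) by rwa [hgz x fun hxU => hUU x hxU (hWU hxW)]⟩

/-- A `π`-regular operator defined on a family `N` of open sets. -/
def IsExtender (f : C(X, Y)) (N : Set (Opens X)) (e : Opens X → Opens Y) : Prop :=
  (∀ U ∈ N, ∀ V ∈ N, Disjoint U V → Disjoint (e U) (e V)) ∧ ∀ U ∈ N, DenseIn ((e U).comap f) U

lemma IsExtender.mono {f : C(X, Y)} {M N : Set (Opens X)} {e : Opens X → Opens Y}
    (h : IsExtender f N e) (hMN : M ⊆ N) : IsExtender f M e :=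
  ⟨fun U hU V hV => h.1 U (hMN hU) V (hMN hV), fun U hU => h.2 U (hMN hU)⟩

lemma IsWinning.exists_isExtender_of_countable [CompletelyRegularSpace Y] (hσ : IsWinning σ)
    {f : C(X, Y)} (hf : Topology.IsEmbedding f) {N : Set (Opens X)} (hN : N.Countable) :
    ∃ e, IsExtender f N e := by
  classical
  choose G H hGH hG hH using hσ.exists_separation hf
  obtain ⟨rk, hrk⟩ := Set.countable_iff_exists_injOn.1 hN
  have hfin : ∀ U, {V ∈ N | rk V ≤ rk U ∧ Disjoint U V}.Finite := fun U =>
    Set.Finite.of_finite_image ((Set.finite_Iic (rk U)).subset (by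
      rintro _ ⟨V, hV, rfl⟩; exact hV.2.1)) (hrk.mono fun V hV => hV.1)
  -- Only the finitely many `V` enumerated no later than `U` are cut off, so density of the trace
  -- survives.
  let e : Opens X → Opens Y := fun U => G U ⊓ (hfin U).toFinset.inf H
  have hle : ∀ U ∈ N, ∀ V ∈ N, rk V ≤ rk U → Disjoint U V → Disjoint (e U) (e V) := by
    intro U hU V hV hle hd
    refine (hGH V).symm.mono (inf_le_right.trans (Finset.inf_le ?_)) inf_le_left
    exact (hfin U).mem_toFinset.2 ⟨hV, hle, hd⟩
  refine ⟨e, fun U hU V hV hd => ?_, fun U hU => ?_⟩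
  · rcases le_total (rk V) (rk U) with h | h
    · exact hle U hU V hV h hd
    · exact (hle V hV U hU h hd.symm).symm
  · have key : ∀ s : Finset (Opens X), (∀ V ∈ s, Disjoint U V) →
        DenseIn ((G U ⊓ s.inf H).comap f) U := by
      intro s
      induction s using Finset.induction_on with
      | empty => intro _; simpa using hG U
      | insert V s hVs ih =>
        intro hs
        rw [Finset.inf_insert, inf_left_comm, inf_comm, map_inf]
        refine (ih fun W hW => hs W (Finset.mem_insert_of_mem hW)).inf fun W hW hWU => ?_
        exact (hH V).2 W hW (le_compl_iff_disjoint_right.2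
          ((hs V (Finset.mem_insert_self _ _)).mono_left hWU))
    exact key _ fun V hV => ((hfin U).mem_toFinset.1 hV).2.2

end Favorable

/-! ### Transfinite amalgamation of extension operators -/

section Extension

variable {X : Type u} [TopologicalSpace X] {Y : Type v} [TopologicalSpace Y]
  {σ : List (Opens X) → Opens X}

/-- Extenders defined on the levels of a well-ordered filtration of `N` by regular families can be
amalgamated. -/
lemma exists_isExtender_of_rank {I : Type w} [LinearOrder I] [WellFoundedLT I] {f : C(X, Y)}
    {N : Set (Opens X)} (rk : Opens X → I)
    (hreg : ∀ i, (∃ U ∈ N, rk U < i) → IsRegularFamily {U ∈ N | rk U < i})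
    (hinf : ∀ i, ∀ U ∈ N, ∀ V ∈ N, rk U < i → rk V < i → U ⊓ V ∈ N ∧ rk (U ⊓ V) < i)
    (hext : ∀ i, ∃ e, IsExtender f {U ∈ N | rk U ≤ i} e) :
    ∃ e, IsExtender f N e := by
  classical
  choose e₀ he₀ using hext
  let R : Opens X → Opens X → Prop := fun U r =>
    r ∈ N ∧ ∀ s ∈ N, rk s < rk U → s ≠ ⊥ → s ≤ r → ¬ Disjoint s U
  have hwf : WellFounded fun U V : Opens X => rk U < rk V := InvImage.wf rk wellFounded_lt
  -- The factor `e₀` separates sets of equal rank; the union over reductions `r` of `U` separates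
  -- `U` from sets of lower rank. At the lowest rank there is nothing to reduce to, hence `⊤`.
  let e : Opens X → Opens Y := hwf.fix fun U e' => e₀ (rk U) U ⊓
    if ∃ V ∈ N, rk V < rk U then ⨆ (r : Opens X) (h : rk r < rk U) (_ : R U r), e' r h else ⊤
  have he : ∀ U, e U = e₀ (rk U) U ⊓
      if ∃ V ∈ N, rk V < rk U then ⨆ (r : Opens X) (_ : rk r < rk U) (_ : R U r), e r else ⊤ :=
    fun U => hwf.fix_eq _ U
  have hle : ∀ U, e U ≤ e₀ (rk U) U := fun U => (he U).trans_le inf_le_left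
  refine ⟨e, ?_, ?_⟩
  · have key : ∀ i, ∀ U ∈ N, ∀ V ∈ N, rk U ≤ i → rk V ≤ i → Disjoint U V →
        Disjoint (e U) (e V) := by
      intro i
      induction i using WellFoundedLT.induction with
      | ind i ih =>
      have hlt : ∀ U ∈ N, ∀ V ∈ N, rk U ≤ i → rk V < rk U → Disjoint U V →
          Disjoint (e U) (e V) := by
        intro U hU V hV hUi hVU hd
        have : e U ≤ ⨆ (r : Opens X) (_ : rk r < rk U) (_ : R U r), e r := by
          refine (he U).trans_le (inf_le_right.trans ?_)
          rw [if_pos ⟨V, hV, hVU⟩]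
        refine Disjoint.mono_left this ?_
        simp only [iSup_disjoint_iff]
        intro r hr hR
        -- Otherwise `r ⊓ V` would be a non-empty member of lower rank below `r` that misses `U`.
        have hrV : Disjoint r V := by
          by_contra hc
          obtain ⟨h1, h2⟩ := hinf (rk U) r hR.1 V hV hr hVU
          exact hR.2 _ h1 h2 (ne_bot_of_not_disjoint hc) inf_le_left
            (hd.symm.mono_left inf_le_right)
        exact ih (max (rk r) (rk V)) ((max_lt hr hVU).trans_le hUi) r hR.1 V hV
          (le_max_left _ _) (le_max_right _ _) hrV
      intro U hU V hV hUi hVi hd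
      rcases lt_trichotomy (rk V) (rk U) with h | h | h
      · exact hlt U hU V hV hUi h hd
      · refine ((he₀ (rk U)).1 U ⟨hU, le_rfl⟩ V ⟨hV, h.le⟩ hd).mono (hle U) ?_
        exact h ▸ hle V
      · exact (hlt V hV U hU hVi h hd.symm).symm
    exact fun U hU V hV => key (max (rk U) (rk V)) U hU V hV (le_max_left _ _) (le_max_right _ _)
  · have key : ∀ i, ∀ U ∈ N, rk U = i → DenseIn ((e U).comap f) U := by
      intro i
      induction i using WellFoundedLT.induction with
      | ind i ih =>
      rintro U hU rfl
      have h0 := (he₀ (rk U)).2 U ⟨hU, le_rfl⟩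
      rw [he U]
      split_ifs with hex
      · rw [map_inf]
        refine h0.inf fun W hW hWU hd => ?_
        obtain ⟨r, ⟨hrN, hrU⟩, hr0, hr⟩ := hreg (rk U) hex W hW
        have hR : R U r := ⟨hrN, fun s hs hsU hs0 hsr hd =>
          hr s ⟨hs, hsU⟩ hs0 hsr (hd.mono_right hWU)⟩
        have hWr : W ⊓ r ≠ ⊥ := by
          rw [inf_comm]; exact ne_bot_of_not_disjoint (hr r ⟨hrN, hrU⟩ hr0 le_rfl)
        refine (ih _ hrU r hrN rfl).2 _ hWr inf_le_right (hd.mono inf_le_left ?_)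
        exact Opens.comap_mono f (le_iSup₂_of_le r hrU (le_iSup_of_le hR le_rfl))
      · simpa using h0
    exact fun U hU => key _ U hU rfl

/-- The operations on open sets given by a strategy and by finite intersections. -/
def strategyOps (σ : List (Opens X) → Opens X) : Bool → List (Opens X) → Opens X :=
  fun b l => bif b then σ l else l.foldr (· ⊓ ·) ⊤

open Cardinal in
lemma IsWinning.exists_isExtender [CompletelyRegularSpace Y] (hσ : IsWinning σ) {f : C(X, Y)}
    (hf : Topology.IsEmbedding f) (c : Cardinal.{u}) :
    ∀ N : Set (Opens X), OpClosed (strategyOps σ) N → #N = c → ∃ e, IsExtender f N e := by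
  induction c using WellFoundedLT.induction with
  | ind c ih =>
  intro N hN hNc
  by_cases hc : N.Countable
  · exact hσ.exists_isExtender_of_countable hf hc
  have hℵ : ℵ₀ < c := by rw [← hNc]; exact not_le.1 fun h => hc (le_aleph0_iff_set_countable.1 h)
  let I := c.ord.ToType
  obtain ⟨b⟩ : Nonempty (I ≃ N) := Cardinal.eq.1 (by rw [mk_ord_toType, hNc])
  -- Initial segments of the initial ordinal of `c` have size below `c`, and so do their closures;
  -- the rank of a set is the first level containing it.
  let L : I → Set (Opens X) := fun i =>
    opClosure (strategyOps σ) ((fun j => (b j : Opens X)) '' Iic i)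
  have hLc : ∀ i, OpClosed (strategyOps σ) (L i) := fun i => opClosed_opClosure
  have hLmono : Monotone L := fun i j hij => opClosure_mono (image_mono (Iic_subset_Iic.2 hij))
  have hLN : ∀ i, L i ⊆ N := fun i => opClosure_min hN (by rintro _ ⟨j, -, rfl⟩; exact (b j).2)
  have hIio : ∀ i : I, #(Iio i) < c := fun i =>
    (mk_Iio_lt i (by rw [mk_ord_toType, Ordinal.type_toType])).trans_eq (mk_ord_toType c)
  have hLcard : ∀ i, #(L i) < c := by
    intro i
    have h1 : #(Iic i) < c := by
      rw [← Iio_insert]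
      exact mk_insert_le.trans_lt (add_lt_of_lt hℵ.le (hIio i)
        (one_lt_aleph0.trans hℵ))
    exact (mk_opClosure_le (le_max_left ℵ₀ #(Iic i)) (mk_image_le.trans (le_max_right _ _))).trans_lt
      (max_lt hℵ h1)
  have hmem : ∀ U ∈ N, ∃ i, U ∈ L i := fun U hU =>
    ⟨b.symm ⟨U, hU⟩, subset_opClosure ⟨b.symm ⟨U, hU⟩, mem_Iic.2 le_rfl, by simp⟩⟩
  have : Nonempty I := by
    rw [← mk_ne_zero_iff, mk_ord_toType]
    exact (aleph0_pos.trans hℵ).ne'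
  have hrk : ∀ U, ∃ i, U ∈ N → U ∈ L i ∧ ∀ j, U ∈ L j → i ≤ j := by
    intro U
    by_cases hU : U ∈ N
    · exact ⟨wellFounded_lt.min {i | U ∈ L i} (hmem U hU), fun _ =>
        ⟨wellFounded_lt.min_mem _ (hmem U hU), fun j hj => not_lt.1 (wellFounded_lt.not_lt_min {i | U ∈ L i} hj)⟩⟩
    · exact ⟨Classical.arbitrary I, fun h => absurd h hU⟩
  choose rk hrk using hrk
  have hle : ∀ i, ∀ U ∈ N, rk U ≤ i ↔ U ∈ L i := fun i U hU =>
    ⟨fun h => hLmono h (hrk U hU).1, (hrk U hU).2 i⟩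
  have hLinf : ∀ i, ∀ U ∈ L i, ∀ V ∈ L i, U ⊓ V ∈ L i := fun i U hU V hV => by
    simpa [strategyOps] using hLc i false [U, V] (by simp [hU, hV])
  refine exists_isExtender_of_rank rk (fun i hex => ?_) (fun i U hU V hV hUi hVi => ?_) fun i => ?_
  · refine hσ.isRegularFamily fun l hl => ?_
    -- A finite list lies in one level below `i`; for the empty list such a level comes from `hex`.
    have hl' : ∃ j < i, ∀ a ∈ l, a ∈ L j := by
      induction l with
      | nil =>
        obtain ⟨V, -, hV⟩ := hex
        exact ⟨rk V, hV, by simp⟩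
      | cons a l ihl =>
        obtain ⟨j, hji, hj⟩ := ihl fun a ha => hl a (List.mem_cons_of_mem _ ha)
        obtain ⟨haN, hai⟩ := hl a List.mem_cons_self
        refine ⟨max j (rk a), max_lt hji hai, fun x hx => ?_⟩
        rcases List.mem_cons.1 hx with rfl | hx
        · exact hLmono (le_max_right _ _) (hrk x haN).1
        · exact hLmono (le_max_left _ _) (hj x hx)
    obtain ⟨j, hji, hj⟩ := hl'
    have := hLc j true l hj
    exact ⟨hLN j this, ((hrk _ (hLN j this)).2 j this).trans_lt hji⟩
  · have hm : U ⊓ V ∈ L (max (rk U) (rk V)) :=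
      hLinf _ U (hLmono (le_max_left _ _) (hrk U hU).1) V (hLmono (le_max_right _ _) (hrk V hV).1)
    exact ⟨hLN _ hm, ((hrk _ (hLN _ hm)).2 _ hm).trans_lt (max_lt hUi hVi)⟩
  · obtain ⟨e, he⟩ := ih _ (hLcard i) (L i) (hLc i) rfl
    exact ⟨e, he.mono fun U hU => (hle i U hU.1).1 hU.2⟩

theorem IFavorable.everyEmbeddingPiRegular (h : IFavorable X) :
    EveryEmbeddingPiRegular.{u, v} X := by
  obtain ⟨σ, hσ⟩ := h
  intro Y _ _ f hf
  obtain ⟨e, he⟩ := IsWinning.exists_isExtender (σ := σ) hσ (f := ⟨f, hf.continuous⟩) hf _ univ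
    (fun _ _ _ => mem_univ _) rfl
  exact ⟨e, fun U V => he.1 U trivial V trivial, fun U => ⟨(he.2 U trivial).1,
    (he.2 U trivial).subset_closure⟩⟩

end Extension

/-! ### From skeletal systems to a winning strategy -/

section LimitToFavorable

variable {A : Type u} [PartialOrder A]

/-- If `φ` induces the topology of `Z` from the limit of a system over a directed index set, then
the preimages of open sets of the spaces of the system form a base of `Z`, where moreover only the
indices above a given one are needed. -/
lemma SpaceSystem.exists_coordinate_nhd [IsDirectedOrder A] (S : SpaceSystem.{u, v} A)
    {Z : Type w} [TopologicalSpace Z] {φ : Z → S.limit} (hφ : Topology.IsInducing φ) (a : A)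
    {O : Set Z} (hO : IsOpen O) {z : Z} (hz : z ∈ O) :
    ∃ c, a ≤ c ∧ ∃ V : Set (S.space c), IsOpen V ∧ (φ z).1 c ∈ V ∧
      ∀ z', (φ z').1 c ∈ V → z' ∈ O := by
  classical
  have hind := Topology.IsInducing.subtypeVal.comp hφ
  have hmem := hO.mem_nhds hz
  rw [hind.nhds_eq_comap, nhds_pi, Filter.mem_comap] at hmem
  obtain ⟨T, hT, hTO⟩ := hmem
  obtain ⟨I, t, ht, hIT⟩ := Filter.mem_pi'.1 hT
  have : Nonempty A := ⟨a⟩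
  obtain ⟨c, hc⟩ := (insert a I).exists_le
  have hIc : ∀ i : I, i.1 ≤ c := fun i => hc i (Finset.mem_insert_of_mem i.2)
  refine ⟨c, hc a (Finset.mem_insert_self _ _), ⋂ i : I, S.bond (hIc i) ⁻¹' interior (t i),
    isOpen_iInter_of_finite fun i => isOpen_interior.preimage (S.continuous_bond _),
    mem_iInter.2 fun i => ?_, fun z' hz' => hTO (hIT fun i hi => ?_)⟩
  · rw [mem_preimage, (φ z).2 i c (hIc i)]
    exact mem_interior_iff_mem_nhds.2 (ht i)
  · have := mem_iInter.1 hz' ⟨i, hi⟩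
    rw [mem_preimage, (φ z').2 i c (hIc ⟨i, hi⟩)] at this
    exact interior_subset this

lemma exists_seq_nonempty_open (Z : Type v) [TopologicalSpace Z] [SecondCountableTopology Z]
    [Nonempty Z] : ∃ B : ℕ → Set Z, (∀ n, IsOpen (B n)) ∧ (∀ n, (B n).Nonempty) ∧
      ∀ V, IsOpen V → V.Nonempty → ∃ n, B n ⊆ V := by
  have hb := isBasis_countableBasis Z
  have hex : ∀ V : Set Z, IsOpen V → V.Nonempty → ∃ W ∈ countableBasis Z, W ⊆ V :=
    fun V hV ⟨z, hz⟩ => by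
      obtain ⟨W, hW, -, hWV⟩ := hb.exists_subset_of_mem_open hz hV
      exact ⟨W, hW, hWV⟩
  obtain ⟨W, hW, -⟩ := hex univ isOpen_univ univ_nonempty
  obtain ⟨B, hB⟩ := (countable_countableBasis Z).exists_eq_range ⟨W, hW⟩
  have hBn : ∀ n, B n ∈ countableBasis Z := fun n => hB ▸ mem_range_self n
  refine ⟨B, fun n => isOpen_of_mem_countableBasis (hBn n),
    fun n => nonempty_of_mem_countableBasis (hBn n), fun V hV hV0 => ?_⟩
  obtain ⟨W, hW, hWV⟩ := hex V hV hV0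
  obtain ⟨n, rfl⟩ : W ∈ range B := hB ▸ hW
  exact ⟨n, hWV⟩

theorem SkeletallyGenerated.iFavorable {X : Type u} [TopologicalSpace X] [Nonempty X]
    (h : SkeletallyGenerated X) : IFavorable X := by
  classical
  obtain ⟨A, _, ⟨a₀⟩, _, S, hS, hsc, hsk, φ, hφ, hsurj⟩ := h
  have hpc : ∀ a, Continuous fun x => (φ x).1 a := fun a =>
    (continuous_apply a).comp (continuous_subtype_val.comp hφ.continuous)
  have hne : ∀ a, Nonempty (S.space a) := fun a => ‹Nonempty X›.map fun x => (φ x).1 a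
  choose B hBo hB0 hB using fun a => exists_seq_nonempty_open (S.space a)
  have hstep : ∀ (a : A) (U : Opens X), ∃ c, a ≤ c ∧ ∃ V : Set (S.space c), IsOpen V ∧
      ((U : Set X).Nonempty → (∃ x, (φ x).1 c ∈ V) ∧ ∀ x, (φ x).1 c ∈ V → x ∈ U) := by
    intro a U
    by_cases hU : (U : Set X).Nonempty
    · obtain ⟨x, hx⟩ := hU
      obtain ⟨c, hac, V, hV, hxV, hVU⟩ := S.exists_coordinate_nhd hφ.isInducing a U.isOpen hx
      exact ⟨c, hac, V, hV, fun _ => ⟨⟨x, hxV⟩, hVU⟩⟩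
    · exact ⟨a, le_rfl, univ, isOpen_univ, fun h => absurd h hU⟩
  choose st hst V hVo hV using hstep
  let idx : List (Opens X) → A := fun l => l.foldl st a₀
  have hidx : ∀ l U, idx (l ++ [U]) = st (idx l) U := fun l U => by simp [idx]
  -- At move `Nat.pair k j`, player I plays the `j`-th π-base set of the `k`-th space. Since `k ≤
  -- Nat.pair k j`, the first `k` moves, which determine that space, are already known.
  let σ : List (Opens X) → Opens X := fun l =>
    ⟨(fun x => (φ x).1 (idx (l.take l.length.unpair.1))) ⁻¹' B _ l.length.unpair.2,
      (hBo _ _).preimage (hpc _)⟩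
  refine ⟨σ, fun l => ?_, fun U hU hUσ => ?_⟩
  · obtain ⟨z, hz⟩ := hB0 (idx (l.take l.length.unpair.1)) l.length.unpair.2
    obtain ⟨x, rfl⟩ := hsurj _ z
    exact ⟨x, hz⟩
  let α : ℕ → A := fun n => idx ((List.range n).map U)
  have hαs : ∀ n, α (n + 1) = st (α n) (U n) := fun n => by
    simp only [α, List.range_succ, List.map_append, List.map_cons, List.map_nil, hidx]
  have hα : Monotone α := monotone_nat_of_le_succ fun n => (hst _ _).trans_eq (hαs n).symm
  obtain ⟨β, hβ⟩ := hS.exists_sup (range α) (range_nonempty _) (countable_range _)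
    hα.isChain_range
  have hle : ∀ n, α n ≤ β := fun n => hβ.1 (mem_range_self n)
  have hσB : ∀ k j x, x ∈ U (Nat.pair k j) → (φ x).1 (α k) ∈ B (α k) j := by
    intro k j x hx
    have h1 := hUσ _ hx
    have h2 : (φ x).1 (idx (((List.range (Nat.pair k j)).map U).take
        ((List.range (Nat.pair k j)).map U).length.unpair.1)) ∈
        B _ ((List.range (Nat.pair k j)).map U).length.unpair.2 := h1
    have h3 : ((List.range (Nat.pair k j)).map U).length = Nat.pair k j := by simp
    rw [h3, Nat.unpair_pair] at h2
    have h4 : ((List.range (Nat.pair k j)).map U).take k = (List.range k).map U := by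
      rw [← List.map_take, List.take_range, min_eq_left (Nat.left_le_pair k j)]
    rw [h4] at h2
    exact h2
  rw [dense_iff_inter_open]
  rintro O hO ⟨x, hx⟩
  obtain ⟨γ, hβγ, V₀, hV₀, hxV₀, hV₀O⟩ := S.exists_coordinate_nhd hφ.isInducing β hO hx
  -- The image of `V₀` is dense in some open set of the space at `β`. As this space embeds in the
  -- sequential limit, that open set contains the preimage of an open `V'` from some `α k`.
  obtain ⟨z, hz⟩ := hsk β γ hβγ V₀ hV₀ ⟨_, hxV₀⟩
  obtain ⟨k, -, V', hV', hzV', hV'T⟩ := (S.alongSeq α hα).exists_coordinate_nhd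
    (hS.dense_embedding α hα β hβ).1.isInducing 0 isOpen_interior hz
  obtain ⟨j, hj⟩ := hB (α k) V' hV' ⟨_, hzV'⟩
  set n := Nat.pair k j with hn
  have hst_le : st (α n) (U n) ≤ β := hαs n ▸ hle (n + 1)
  obtain ⟨⟨x₁, hx₁⟩, hVn⟩ := hV (α n) (U n) (hU n)
  have hx₁T : (φ x₁).1 β ∈ interior (closure (S.bond hβγ '' V₀)) := by
    apply hV'T
    have := hj (hσB k j x₁ (hVn x₁ hx₁))
    rwa [← (φ x₁).2 (α k) β (hle k)] at this
  -- The part of `U n` captured at index `α (n + 1) ≤ β` is visible at `β`, so it meets the image of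
  -- `V₀`.
  obtain ⟨_, hw, v, hv, rfl⟩ := mem_closure_iff.1 (interior_subset hx₁T)
    (S.bond hst_le ⁻¹' V (α n) (U n)) ((hVo _ _).preimage (S.continuous_bond _)) (by
      rwa [mem_preimage, (φ x₁).2 _ β hst_le])
  obtain ⟨x₂, rfl⟩ := hsurj γ v
  refine ⟨x₂, hV₀O _ hv, mem_iUnion.2 ⟨n, hVn x₂ ?_⟩⟩
  have hw' : S.bond hst_le (S.bond hβγ ((φ x₂).1 γ)) ∈ V (α n) (U n) := hw
  rwa [S.bond_bond, (φ x₂).2] at hw'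

end LimitToFavorable

/-! ### The countable chain condition in powers of the real line -/

section Cube

-- A product of Gaussian measures is a probability measure giving each such box positive mass, so
-- only countably many can be disjoint.
open MeasureTheory ProbabilityTheory in
lemma countable_of_pairwiseDisjoint_boxes {ι : Type u} {P : Set (Set (ι → ℝ))}
    (hbox : ∀ b ∈ P, ∃ (s : Finset ι) (t : ι → Set ℝ), (∀ i, IsOpen (t i) ∧ (t i).Nonempty) ∧
      b = (s : Set ι).pi t) (hP : P.PairwiseDisjoint id) : P.Countable := by
  let μ : Measure (ι → ℝ) := Measure.infinitePi fun _ => gaussianReal 0 1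
  have hpos : ∀ t : Set ℝ, IsOpen t → t.Nonempty → 0 < gaussianReal 0 1 t := fun t ht h => by
    refine pos_iff_ne_zero.2 fun h0 => ?_
    have := gaussianReal_absolutelyContinuous' 0 one_ne_zero h0
    exact (ht.measure_pos volume h).ne' this
  have hc := Measure.countable_meas_pos_of_disjoint_iUnion (μ := μ)
    (As := fun b : P => (b : Set (ι → ℝ)))
    (fun b => by
      obtain ⟨s, t, ht, hb⟩ := hbox b b.2
      simp only [hb]
      exact MeasurableSet.pi s.countable_toSet fun i _ => (ht i).1.measurableSet)
    (fun a b hab => hP a.2 b.2 (Subtype.coe_injective.ne hab))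
  have huniv : {b : P | 0 < μ b} = univ := by
    refine eq_univ_of_forall fun b => ?_
    obtain ⟨s, t, ht, hb⟩ := hbox b b.2
    rw [mem_ofPred_eq, hb, Measure.infinitePi_pi _ fun i _ => (ht i).1.measurableSet]
    exact pos_iff_ne_zero.2 (Finset.prod_ne_zero_iff.2 fun i _ => (hpos _ (ht i).1 (ht i).2).ne')
  rw [huniv, countable_univ_iff] at hc
  exact hc

/-- Every open subset of a power of the real line has a dense subset which depends on countably many
coordinates. -/
lemma exists_countable_support {ι : Type u} {O : Set (ι → ℝ)} (hO : IsOpen O) :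
    ∃ J : Set ι, J.Countable ∧ ∃ D ⊆ O, O ⊆ closure D ∧
      ∀ y ∈ D, ∀ y', (∀ j ∈ J, y j = y' j) → y' ∈ D := by
  let B : Set (Set (ι → ℝ)) := {b | (∃ (s : Finset ι) (t : ι → Set ℝ),
    (∀ i, IsOpen (t i) ∧ (t i).Nonempty) ∧ b = (s : Set ι).pi t) ∧ b ⊆ O}
  -- A maximal disjoint family of boxes in `O` has dense union in `O`; it is countable, and each box
  -- restricts finitely many coordinates.
  obtain ⟨P, hP⟩ := zorn_subset {P | P ⊆ B ∧ P.PairwiseDisjoint id} fun c hc hch =>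
    ⟨⋃₀ c, ⟨sUnion_subset fun p hp => (hc hp).1,
      (pairwiseDisjoint_sUnion hch.directedOn).2 fun p hp => (hc hp).2⟩,
      fun p hp => subset_sUnion_of_mem hp⟩
  obtain ⟨hPB, hPd⟩ := hP.prop
  have hPc := countable_of_pairwiseDisjoint_boxes (fun b hb => (hPB hb).1) hPd
  choose! s t ht hb using fun b (hb : b ∈ P) => (hPB hb).1
  refine ⟨⋃ b ∈ P, s b, hPc.biUnion fun b _ => (s b).countable_toSet, ⋃₀ P,
    sUnion_subset fun b hb => (hPB hb).2, fun y hy => ?_, ?_⟩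
  · by_contra hyD
    have hV : O ∩ (closure (⋃₀ P))ᶜ ∈ nhds y :=
      (hO.inter isClosed_closure.isOpen_compl).mem_nhds ⟨hy, hyD⟩
    rw [nhds_pi] at hV
    obtain ⟨I, T, hT, hIT⟩ := Filter.mem_pi'.1 hV
    have hyT : ∀ i, y i ∈ interior (T i) := fun i => mem_interior_iff_mem_nhds.2 (hT i)
    let b := (I : Set ι).pi fun i => interior (T i)
    have hbV : b ⊆ O ∩ (closure (⋃₀ P))ᶜ := (pi_mono fun i _ => interior_subset).trans hIT
    have hins : insert b P ∈ {P | P ⊆ B ∧ P.PairwiseDisjoint id} := by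
      refine ⟨insert_subset ⟨⟨I, _, fun i => ⟨isOpen_interior, _, hyT i⟩, rfl⟩,
        fun z hz => (hbV hz).1⟩ hPB, hPd.insert fun c hc _ => ?_⟩
      exact Set.disjoint_left.2 fun z hz hzc => (hbV hz).2 (subset_closure ⟨c, hc, hzc⟩)
    have hbP : b ∈ P := hP.le_of_ge hins (subset_insert b P) (mem_insert b P)
    exact hyD (subset_closure ⟨b, hbP, fun i _ => hyT i⟩)
  · rintro y ⟨b, hbP, hyb⟩ y' h
    refine ⟨b, hbP, ?_⟩
    rw [hb b hbP] at hyb ⊢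
    intro i hi
    rw [← h i (mem_iUnion₂.2 ⟨b, hbP, hi⟩)]
    exact hyb i hi

end Cube

/-! ### Systems of evaluation images with skeletal bonding maps -/

section EvaluationSystem

variable {X : Type u} [TopologicalSpace X]

/-- The map from `X` to a power of the real line given by the functions in `M`. -/
def evalAt (M : Set C(X, ℝ)) (x : X) : M → ℝ := fun f => f.1 x

lemma continuous_evalAt (M : Set C(X, ℝ)) : Continuous (evalAt M) :=
  continuous_pi fun f => f.1.continuous

/-- The function `max 0 (min (f - p) (q - f))`, which is non-zero precisely on `f ⁻¹' Ioo p q`. -/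
def bump (p q : ℚ) (f : C(X, ℝ)) : C(X, ℝ) :=
  ⟨fun x => max 0 (min (f x - p) (q - f x)), by fun_prop⟩

lemma bump_ne_zero_iff {p q : ℚ} {f : C(X, ℝ)} {x : X} :
    bump p q f x ≠ 0 ↔ f x ∈ Ioo (p : ℝ) q := by
  have h : bump p q f x = max 0 (min (f x - p) (q - f x)) := rfl
  rw [h, ← (le_max_left _ _).lt_iff_ne', lt_max_iff, lt_min_iff, sub_pos, sub_pos]
  simp

/-- The operations on real functions given by products, rational bumps, and a sequence `J` of
unary operations. -/
def functionOps (J : ℕ → C(X, ℝ) → C(X, ℝ)) : Unit ⊕ (ℚ × ℚ) ⊕ ℕ → List C(X, ℝ) → C(X, ℝ)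
  | .inl _, l => l.prod
  | .inr (.inl p), l => bump p.1 p.2 l.prod
  | .inr (.inr n), l => J n l.prod

variable {J : ℕ → C(X, ℝ) → C(X, ℝ)} {M : Set C(X, ℝ)}

lemma OpClosed.one_mem (hM : OpClosed (functionOps J) M) : (1 : C(X, ℝ)) ∈ M :=
  hM (.inl ()) [] (by simp)

lemma OpClosed.mul_mem (hM : OpClosed (functionOps J) M) {f g : C(X, ℝ)} (hf : f ∈ M)
    (hg : g ∈ M) : f * g ∈ M := by
  simpa [functionOps] using hM (.inl ()) [f, g] (by simp [hf, hg])

lemma OpClosed.bump_mem (hM : OpClosed (functionOps J) M) {f : C(X, ℝ)} (hf : f ∈ M) (p q : ℚ) :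
    bump p q f ∈ M := by
  simpa [functionOps] using hM (.inr (.inl (p, q))) [f] (by simp [hf])

lemma OpClosed.unary_mem (hM : OpClosed (functionOps J) M) {f : C(X, ℝ)} (hf : f ∈ M) (n : ℕ) :
    J n f ∈ M := by
  simpa [functionOps] using hM (.inr (.inr n)) [f] (by simp [hf])

/-- The cozero sets of the members of a closed family form a base of the topology induced by the
family. -/
lemma OpClosed.exists_cozero_nhd (hM : OpClosed (functionOps J) M) {x : X} {V : Set (M → ℝ)}
    (hV : V ∈ nhds (evalAt M x)) :
    ∃ f ∈ M, f x ≠ 0 ∧ ∀ x', f x' ≠ 0 → evalAt M x' ∈ V := by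
  classical
  rw [nhds_pi] at hV
  obtain ⟨I, T, hT, hIT⟩ := Filter.mem_pi'.1 hV
  have key : ∀ s : Finset M, ∃ f ∈ M, f x ≠ 0 ∧ ∀ x', f x' ≠ 0 → ∀ i ∈ s, evalAt M x' i ∈ T i := by
    intro s
    induction s using Finset.induction_on with
    | empty => exact ⟨1, hM.one_mem, by simp, by simp⟩
    | insert i s _ ih =>
      obtain ⟨f, hf, hfx, hfs⟩ := ih
      obtain ⟨ε, hε, hεT⟩ := Metric.mem_nhds_iff.1 (hT i)
      obtain ⟨p, hp, hp'⟩ := exists_rat_btwn (sub_lt_self (evalAt M x i) hε)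
      obtain ⟨q, hq, hq'⟩ := exists_rat_btwn (lt_add_of_pos_right (evalAt M x i) hε)
      refine ⟨bump p q i * f, hM.mul_mem (hM.bump_mem i.2 p q) hf,
        mul_ne_zero (bump_ne_zero_iff.2 ⟨hp', hq⟩) hfx, fun x' hx' j hj => ?_⟩
      obtain ⟨h1, h2⟩ := mul_ne_zero_iff.1 hx'
      rcases Finset.mem_insert.1 hj with rfl | hj
      · apply hεT
        rw [Real.ball_eq_Ioo]
        have := bump_ne_zero_iff.1 h1
        exact ⟨hp.trans this.1, this.2.trans hq'⟩
      · exact hfs x' h2 j hj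
  obtain ⟨f, hf, hfx, hfI⟩ := key I
  exact ⟨f, hf, hfx, fun x' hx' => hIT fun i hi => hfI x' hx' i hi⟩

/-- The restriction of coordinates between the images of `X` given by two families. -/
def restrictCoords {M N : Set C(X, ℝ)} (h : M ⊆ N) (z : range (evalAt N)) : range (evalAt M) :=
  ⟨fun f => z.1 ⟨f, h f.2⟩, by obtain ⟨_, x, rfl⟩ := z; exact ⟨x, rfl⟩⟩

lemma continuous_restrictCoords {M N : Set C(X, ℝ)} (h : M ⊆ N) :
    Continuous (restrictCoords h) :=
  continuous_induced_rng.2 (continuous_pi fun f =>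
    (continuous_apply (⟨f.1, h f.2⟩ : N)).comp continuous_subtype_val)

/-- The inverse system of the images of `X` given by the countable families of functions closed
under some finitary operations. -/
def evalSystem {κ : Type} (F : κ → List C(X, ℝ) → C(X, ℝ)) :
    SpaceSystem.{u, u} {M : Set C(X, ℝ) // M.Countable ∧ OpClosed F M} where
  space M := range (evalAt M.1)
  bond h := restrictCoords h
  continuous_bond h := continuous_restrictCoords h
  bond_refl _ _ := rfl
  bond_bond _ _ _ := rfl

section

variable {κ : Type} {F : κ → List C(X, ℝ) → C(X, ℝ)}

lemma countable_opClosed_iUnion {ι : Type w} [Nonempty ι] [Countable ι]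
    {N : ι → {M : Set C(X, ℝ) // M.Countable ∧ OpClosed F M}} (hd : Directed (· ≤ ·) N) :
    (⋃ i, (N i).1).Countable ∧ OpClosed F (⋃ i, (N i).1) :=
  ⟨countable_iUnion fun i => (N i).2.1,
    OpClosed.iUnion hd fun i k l hl => mem_iUnion.2 ⟨i, (N i).2.2 k l hl⟩⟩

lemma isAlmostSigmaContinuous_evalSystem : (evalSystem F).IsAlmostSigmaContinuous where
  exists_sup C hC hCc hch := by
    have := hC.to_subtype
    have := hCc.to_subtype
    refine ⟨⟨_, countable_opClosed_iUnion (N := fun M : C => M.1) ?_⟩, fun M hM => ?_,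
      fun M hM => ?_⟩
    · exact hch.directedOn.directed_val
    · exact subset_iUnion (fun M : C => M.1.1) ⟨M, hM⟩
    · exact iUnion_subset fun N => hM N.2
  dense_embedding a ha b hb := by
    have hbU : b.1 ⊆ ⋃ n, (a n).1 := by
      have hub : (⟨_, countable_opClosed_iUnion ha.directed_le⟩ :
          {M : Set C(X, ℝ) // M.Countable ∧ OpClosed F M}) ∈ upperBounds (range a) := by
        rintro _ ⟨n, rfl⟩
        exact subset_iUnion (fun n => (a n).1) n
      exact hb.2 hub
    choose n hn using fun f : b.1 => mem_iUnion.1 (hbU f.2)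
    constructor
    -- A continuous left inverse: coordinate `f` is read at a stage where `f` has already appeared.
    · let g : ((evalSystem F).alongSeq a ha).limit → (b.1 → ℝ) :=
        fun t f => (t.1 (n f)).1 ⟨f, hn f⟩
      have hg : Continuous g := continuous_pi fun f =>
        (continuous_apply (⟨f.1, hn f⟩ : (a (n f)).1)).comp
          (continuous_subtype_val.comp ((continuous_apply (n f)).comp continuous_subtype_val))
      refine Topology.IsEmbedding.of_comp ?_ hg ?_
      · exact Continuous.subtype_mk (continuous_pi fun m =>
          (evalSystem F).continuous_bond _) _
      · exact Topology.IsEmbedding.subtypeVal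
    · intro t
      rw [mem_closure_iff]
      intro o ho hto
      obtain ⟨m, -, V, hV, htV, hVo⟩ := ((evalSystem F).alongSeq a ha).exists_coordinate_nhd
        Topology.IsInducing.id 0 ho hto
      obtain ⟨x, hx⟩ : (t.1 m).1 ∈ range (evalAt (a m).1) := (t.1 m).2
      refine ⟨_, hVo _ ?_, ⟨evalAt b.1 x, x, rfl⟩, rfl⟩
      have : (t.1 m) = (⟨evalAt (a m).1 x, x, rfl⟩ : range (evalAt (a m).1)) := Subtype.ext hx.symm
      have htV' : t.1 m ∈ V := htV
      rw [this] at htV'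
      exact htV'

lemma isEmbedding_eval [T35Space X] {ι : Type w} {a : ι → C(X, ℝ)} (ha : Function.Surjective a) :
    Topology.IsEmbedding fun x i => a i x := by
  have hc : Continuous fun x i => a i x := continuous_pi fun i => (a i).continuous
  refine Topology.IsInducing.isEmbedding (Topology.isInducing_iff_nhds.2 fun x =>
    le_antisymm hc.continuousAt.le_comap fun O hO => ?_)
  obtain ⟨O', hO', hOo, hxO⟩ := mem_nhds_iff.1 hO
  obtain ⟨ψ, hψ, hψx, hψO⟩ := CompletelyRegularSpace.completely_regular x O'ᶜ hOo.isClosed_compl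
    (by simpa using hxO)
  obtain ⟨i, hi⟩ := ha ⟨fun x => (ψ x : ℝ), by fun_prop⟩
  refine ⟨{y | y i < 1}, (isOpen_lt (continuous_apply i) continuous_const).mem_nhds ?_,
    fun z hz => hO' ?_⟩
  · simp [hi, hψx]
  · by_contra hzO
    have h1 : ψ z = 1 := hψO hzO
    simp [hi, h1] at hz

lemma isAlmostLimit_evalSystem [T35Space X] [Countable κ] : (evalSystem F).IsAlmostLimit X := by
  let g : (evalSystem F).limit → (C(X, ℝ) → ℝ) := fun t f =>
    (t.1 ⟨opClosure F {f}, countable_opClosure (countable_singleton f), opClosed_opClosure⟩).1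
      ⟨f, subset_opClosure rfl⟩
  have hg : Continuous g := continuous_pi fun f =>
    (continuous_apply (⟨f, subset_opClosure rfl⟩ : opClosure F {f})).comp
      (continuous_subtype_val.comp ((continuous_apply _).comp continuous_subtype_val))
  refine ⟨fun x => ⟨fun M => ⟨evalAt M.1 x, x, rfl⟩, fun _ _ _ => rfl⟩,
    Topology.IsEmbedding.of_comp ?_ hg (isEmbedding_eval Function.surjective_id), ?_⟩
  · exact continuous_induced_rng.2 (continuous_pi fun M =>
      continuous_induced_rng.2 (continuous_evalAt M.1))
  · rintro M ⟨_, x, rfl⟩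
    exact ⟨x, rfl⟩

end

/-- The cozero set of a real function. -/
def cozero (f : C(X, ℝ)) : Opens X := ⟨{x | f x ≠ 0}, isOpen_ne_fun f.continuous continuous_const⟩

/-- The cozero sets of members of `M` form a regular family. -/
def IsRegularFunctionFamily (M : Set C(X, ℝ)) : Prop :=
  ∀ U : Set X, IsOpen U → U.Nonempty → ∃ f ∈ M, (∃ x, f x ≠ 0) ∧
    ∀ g ∈ M, (∃ x, g x ≠ 0) → (∀ x, g x ≠ 0 → f x ≠ 0) → ∃ x ∈ U, g x ≠ 0

/-- If `f` reduces the preimage of `V` in `X`, the image of `V` is dense in the open set where the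
coordinate `f` is non-zero: a basic set there is given by a product `f * f₁`, again in `M`. -/
lemma isSkeletal_restrictCoords {M N : Set C(X, ℝ)} (hM : OpClosed (functionOps J) M)
    (hreg : IsRegularFunctionFamily M) (h : M ⊆ N) : IsSkeletal (restrictCoords h) := by
  rintro V hV ⟨⟨_, x₀, rfl⟩, hx₀⟩
  have hq : Continuous fun x => (⟨evalAt N x, x, rfl⟩ : range (evalAt N)) :=
    continuous_induced_rng.2 (continuous_evalAt N)
  obtain ⟨f, hf, ⟨x₁, hx₁⟩, hfU⟩ := hreg _ (hV.preimage hq) ⟨x₀, hx₀⟩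
  refine ⟨⟨evalAt M x₁, x₁, rfl⟩, mem_interior.2 ⟨{z | z.1 ⟨f, hf⟩ ≠ 0}, ?_, ?_, hx₁⟩⟩
  · rintro ⟨_, x₂, rfl⟩ hx₂
    rw [mem_closure_iff]
    rintro _ ⟨O, hO, rfl⟩ hxO
    obtain ⟨f₁, hf₁, hfx, hfO⟩ := hM.exists_cozero_nhd (hO.mem_nhds hxO)
    obtain ⟨x₃, hx₃, h₃⟩ := hfU (f * f₁) (hM.mul_mem hf hf₁) ⟨x₂, mul_ne_zero hx₂ hfx⟩
      fun x hx => left_ne_zero_of_mul hx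
    exact ⟨⟨evalAt M x₃, x₃, rfl⟩, hfO x₃ (right_ne_zero_of_mul h₃), _, hx₃, rfl⟩
  · exact isOpen_ne_fun ((continuous_apply _).comp continuous_subtype_val) continuous_const

/-- Take a box in `e U` around a point of `X` and keep only its constraints on coordinates from `M`;
an `f ∈ M` subordinate to these is the reduction. The coordinates supporting `D g` belong to `M` for
`g ∈ M`, so the discarded constraints cannot matter for `g`. -/
lemma OpClosed.isRegularFunctionFamily {ι : Type w} {a : ι → C(X, ℝ)}
    {e : Opens X → Opens (ι → ℝ)} (hdis : ∀ U V : Opens X, Disjoint U V → Disjoint (e U) (e V))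
    (hdense : ∀ U : Opens X, (U : Set X) ⊆ closure ((fun x i => a i x) ⁻¹' (e U : Set (ι → ℝ))))
    {S : C(X, ℝ) → Set ι} {D : C(X, ℝ) → Set (ι → ℝ)} (hDe : ∀ g, D g ⊆ e (cozero g))
    (hDd : ∀ g, (e (cozero g) : Set (ι → ℝ)) ⊆ closure (D g))
    (hDS : ∀ g, ∀ y ∈ D g, ∀ y', (∀ j ∈ S g, y j = y' j) → y' ∈ D g)
    (hJ : ∀ g, ∀ j ∈ S g, ∃ n, J n g = a j) (hM : OpClosed (functionOps J) M) :
    IsRegularFunctionFamily M := by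
  classical
  rintro U hU ⟨x₀, hx₀⟩
  obtain ⟨x, hxU, hx⟩ : ∃ x ∈ U, (fun i => a i x) ∈ e ⟨U, hU⟩ :=
    mem_closure_iff.1 (hdense ⟨U, hU⟩ hx₀) U hU hx₀
  have hnhd := (e ⟨U, hU⟩).isOpen.mem_nhds hx
  rw [nhds_pi] at hnhd
  obtain ⟨I, T, hT, hIT⟩ := Filter.mem_pi'.1 hnhd
  let V : Set (M → ℝ) := ⋂ i ∈ I, {z | ∀ h : a i ∈ M, z ⟨a i, h⟩ ∈ interior (T i)}
  have hV : V ∈ nhds (evalAt M x) := by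
    refine (Filter.biInter_finset_mem I).2 fun i _ => ?_
    by_cases h : a i ∈ M
    · have := (continuous_apply (⟨a i, h⟩ : M)).continuousAt.preimage_mem_nhds
        (x := evalAt M x) (interior_mem_nhds.2 (hT i))
      filter_upwards [this] with z hz _ using hz
    · exact Filter.univ_mem' fun z h' => absurd h' h
  obtain ⟨f, hf, hfx, hfV⟩ := hM.exists_cozero_nhd hV
  refine ⟨f, hf, ⟨x, hfx⟩, fun g hg ⟨x₁, hx₁⟩ hgf => ?_⟩
  by_contra! hgU
  have hd : Disjoint (⟨U, hU⟩ : Opens X) (cozero g) :=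
    Opens.coe_disjoint.1 (Set.disjoint_left.2 fun z hz hz' => hz' (hgU z hz))
  have hde := Opens.coe_disjoint.2 (hdis _ _ hd)
  obtain ⟨x₂, hx₂, hx₂e⟩ := mem_closure_iff.1 (hdense (cozero g) hx₁) _ (cozero g).isOpen hx₁
  have hx₂V := hfV x₂ (hgf x₂ hx₂)
  let b : Set (ι → ℝ) := ⋂ i ∈ I, {y | a i ∈ M → y i ∈ interior (T i)}
  have hb : IsOpen b := by
    refine isOpen_biInter_finset fun i _ => ?_
    by_cases h : a i ∈ M
    · simp only [h, forall_true_left]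
      exact isOpen_interior.preimage (continuous_apply i)
    · simp [h]
  obtain ⟨y, hyb, hyD⟩ := mem_closure_iff.1 (hDd g hx₂e) b hb
    (mem_iInter₂.2 fun i hi h => mem_iInter₂.1 hx₂V i hi h)
  -- Changing `y` off `M` keeps it in `D g` and moves it into the full box, so `e U` and `e (cozero
  -- g)` would meet.
  let y' : ι → ℝ := fun i => if a i ∈ M then y i else a i x
  have hy'D : y' ∈ D g := hDS g y hyD y' fun j hj => by
    obtain ⟨n, hn⟩ := hJ g j hj
    have : a j ∈ M := hn ▸ hM.unary_mem hg n
    simp [y', this]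
  refine Set.disjoint_left.1 hde (hIT fun i hi => ?_) (hDe g hy'D)
  by_cases h : a i ∈ M
  · simpa [y', h] using interior_subset (mem_iInter₂.1 hyb i hi h)
  · simpa [y', h] using mem_of_mem_nhds (hT i)

theorem EveryEmbeddingPiRegular.skeletallyGenerated [T35Space X]
    (h : EveryEmbeddingPiRegular.{u, v} X) : SkeletallyGenerated X := by
  -- The lift places the power of the line in the universe over which the hypothesis quantifies.
  let a : ULift.{v} C(X, ℝ) → C(X, ℝ) := ULift.down
  obtain ⟨e, hdis, he⟩ := h (ULift.{v} C(X, ℝ) → ℝ) (fun x i => a i x)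
    (isEmbedding_eval ULift.down_surjective)
  choose S hSc D hDe hDd hDS using fun g : C(X, ℝ) =>
    exists_countable_support (e (cozero g)).isOpen
  have hJ : ∀ g, ∃ J : ℕ → C(X, ℝ), a '' S g ⊆ range J := fun g =>
    countable_iff_exists_subset_range.1 ((hSc g).image a)
  choose J hJ using hJ
  let F := functionOps fun n g => J g n
  have hreg : ∀ M, OpClosed F M → IsRegularFunctionFamily M := fun M hM =>
    OpClosed.isRegularFunctionFamily hdis (fun U => (he U).2) hDe hDd hDS
      (fun g j hj => hJ g ⟨j, hj, rfl⟩) hM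
  refine ⟨{M : Set C(X, ℝ) // M.Countable ∧ OpClosed F M}, inferInstance,
    ⟨⟨_, countable_opClosure countable_empty, opClosed_opClosure⟩⟩, ⟨fun M N => ?_⟩,
    evalSystem F, isAlmostSigmaContinuous_evalSystem, fun M => ?_, fun M N hMN => ?_,
    isAlmostLimit_evalSystem⟩
  · exact ⟨⟨_, countable_opClosure (M.2.1.union N.2.1), opClosed_opClosure⟩,
      subset_union_left.trans subset_opClosure, subset_union_right.trans subset_opClosure⟩
  · have := M.2.1.to_subtype
    exact inferInstanceAs (SecondCountableTopology (range (evalAt M.1)))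
  · exact isSkeletal_restrictCoords M.2.2 (hreg _ M.2.2) hMN

end EvaluationSystem

theorem theorem1p1 (X : Type u) [TopologicalSpace X] [T35Space X] [Nonempty X] :
    [IFavorable X, EveryEmbeddingPiRegular.{u, v} X, SkeletallyGenerated X].TFAE := by
  tfae_have 1 → 2 := IFavorable.everyEmbeddingPiRegular
  tfae_have 2 → 3 := EveryEmbeddingPiRegular.skeletallyGenerated
  tfae_have 3 → 1 := SkeletallyGenerated.iFavorable
  tfae_finish
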